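/- Let $O(3)$ be the group of real orthogonal $3\times 3$ matrices, regarded as a discrete group, and let $M=\bigoplus_{L}L^t$, where $L$ ranges over all one-dimensional vector subspaces of $\mathbb{R}^3$ and the superscript $t$ denotes the twisted action: $g\in O(3)$ sends a vector $v$ in the summand $L$ to the vector $\det(g)\,g v$ in the summand $gL$. Regard $M$ as a $\mathbb{Z}[O(3)]$-module. Then the group homology of $O(3)$ with coefficients in $M$ satisfies $$H_0(O(3),M)=0,\qquad H_1(O(3),M)\cong \mathbb{R}\otimes_{\mathbb{Z}}\mathbb{R}/\mathbb{Z},\qquad H_2(O(3),M)=0.$$ Moreover, the isomorphism of abelian groups in degree $1$ can be chosen so that, for every line $L$, every unit vector $u\in L$, every $\ell\in\mathbb{R}$ and every $\theta\in\mathbb{R}$, if $g\in O(3)$ is the rotation by the angle $\theta$ about the axis oriented by $u$, then $g\otimes \ell u$ (with $\ell u$ placed in the summand $L$) is a $1$-cycle in the inhomogeneous bar complex, and its homology class is sent to $\ell\otimes(\theta/\pi \bmod \mathbb{Z})$. -/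

import Mathlib

open scoped DirectSum TensorProduct Matrix

noncomputable section

/-- The orthogonal group `O(3)` of real `3 × 3` matrices, as an abstract (discrete) group. -/
abbrev O3 : Type := Matrix.orthogonalGroup (Fin 3) ℝ

/-- The one-dimensional vector subspaces of `ℝ³`. -/
abbrev Line : Type := {W : Submodule ℝ (Fin 3 → ℝ) // Module.finrank ℝ W = 1}

/-- The image `g L` of a line under an orthogonal matrix. -/
def Line.map (g : O3) (L : Line) : Line :=
  ⟨L.1.map (Matrix.UnitaryGroup.toLinearEquiv g).toLinearMap, 
    (LinearEquiv.finrank_map_eq (Matrix.UnitaryGroup.toLinearEquiv g) L.1).trans L.2⟩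

theorem Line.mulVec_mem_map (g : O3) (L : Line) (v : L.1) :
    g.1 *ᵥ (v : Fin 3 → ℝ) ∈ (Line.map g L).1 :=
  ⟨v, v.2, rfl⟩

theorem Line.map_one (L : Line) : Line.map 1 L = L := by
  apply Subtype.ext
  ext x
  constructor
  · rintro ⟨y, hy, rfl⟩
    have : (Matrix.UnitaryGroup.toLinearEquiv (1 : O3)) y = y := Matrix.one_mulVec y
    simpa [this] using hy
  · intro hx
    exact ⟨x, hx, Matrix.one_mulVec x⟩

theorem Line.map_mul (g h : O3) (L : Line) :
    Line.map (g * h) L = Line.map g (Line.map h L) := by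
  apply Subtype.ext
  ext x
  constructor
  · rintro ⟨y, hy, rfl⟩
    exact ⟨h.1 *ᵥ y, ⟨y, hy, rfl⟩, Matrix.mulVec_mulVec y g.1 h.1⟩
  · rintro ⟨_, ⟨y, hy, rfl⟩, rfl⟩
    exact ⟨y, hy, (Matrix.mulVec_mulVec y g.1 h.1).symm⟩

/-- The direct sum, over all lines `L` through the origin of `ℝ³`, of the additive groups `L`. -/
abbrev LineSum : Type := ⨁ L : Line, L.1

/-- The twisted action of `g ∈ O(3)` on one summand: `L → g L`, `v ↦ det(g) • g v`. -/
def twistedMap (g : O3) (L : Line) : L.1 →+ (Line.map g L).1 where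
  toFun v := ⟨g.1.det • (g.1 *ᵥ (v : Fin 3 → ℝ)),
    Submodule.smul_mem _ _ (Line.mulVec_mem_map g L v)⟩
  map_zero' := by
    apply Subtype.ext
    simp
  map_add' v w := by
    apply Subtype.ext
    simp [Matrix.mulVec_add]

theorem LineSum.of_congr {L L' : Line} (h : L = L') (v : L.1) (w : L'.1)
    (hvw : (v : Fin 3 → ℝ) = w) :
    DirectSum.of (fun L : Line => L.1) L v = DirectSum.of (fun L : Line => L.1) L' w := by
  subst h
  rw [Subtype.ext hvw]

/-- The action of `g` on the direct sum: the vector `v` in the summand `L` goes to the vector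
`det(g) • g v` in the summand `g L`. -/
def twistedAction (g : O3) : LineSum →+ LineSum :=
  DirectSum.toAddMonoid fun L =>
    (DirectSum.of (fun L : Line => L.1) (Line.map g L)).comp (twistedMap g L)

theorem twistedAction_of (g : O3) (L : Line) (v : L.1) :
    twistedAction g (DirectSum.of (fun L : Line => L.1) L v) =
      DirectSum.of (fun L : Line => L.1) (Line.map g L) (twistedMap g L v) := by
  simp [twistedAction]

theorem twistedAction_one : twistedAction 1 = AddMonoidHom.id LineSum := by
  refine DirectSum.addHom_ext fun L v => ?_
  rw [twistedAction_of]
  refine LineSum.of_congr (Line.map_one L) _ _ ?_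
  simp [twistedMap]

theorem twistedAction_mul (g h : O3) :
    twistedAction (g * h) = (twistedAction g).comp (twistedAction h) := by
  refine DirectSum.addHom_ext fun L v => ?_
  rw [AddMonoidHom.comp_apply, twistedAction_of, twistedAction_of, twistedAction_of]
  refine LineSum.of_congr (Line.map_mul g h L) _ _ ?_
  simp [twistedMap, Matrix.mulVec_smul, smul_smul]

/-- The twisted action as a representation of `O(3)` on an abelian group (a `ℤ[O(3)]`-module). -/
def twistedRepresentation : Representation ℤ O3 LineSum where
  toFun g := (twistedAction g).toIntLinearMap
  map_one' := LinearMap.ext fun x =>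
    DFunLike.congr_fun twistedAction_one x
  map_mul' g h := LinearMap.ext fun x =>
    DFunLike.congr_fun (twistedAction_mul g h) x

/-- The `O(3)`-module `⨁_L Lᵗ`, the sum being over all lines `L` through the origin of `ℝ³`. -/
def twistedLines : Rep.{0} ℤ O3 := Rep.of (X := LineSum) twistedRepresentation

/-- The element `v`, placed in the summand `L`, of `⨁_L Lᵗ`. -/
def lineVector (L : Line) (v : L.1) : twistedLines :=
  (DirectSum.of (fun L : Line => L.1) L v : LineSum)

/-- `g` is the rotation by the angle `θ` about the axis oriented by the unit vector `u`
(right-hand rule), written with Rodrigues' formula. -/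
def IsRotationAbout (u : Fin 3 → ℝ) (θ : ℝ) (g : O3) : Prop :=
  ∀ x : Fin 3 → ℝ, g.1 *ᵥ x =
    Real.cos θ • x + Real.sin θ • (u ⨯₃ x) + ((1 - Real.cos θ) * (u ⬝ᵥ x)) • u

end

/-! The twisted action on unit vectors is transitive, and `M` is generated by symbols `(u, ℓ)`,
additive in `ℓ`, with `(-u, ℓ) = (u, -ℓ)`. As `2` is invertible on `ℝ`, `M` is the odd direct
summand of the module induced from the trivial module `ℝ` of the stabilizer `T` of `e₃`. By
Shapiro's lemma its homology is the odd part of `H_*(T, ℝ)`. Here `T = {± rotZ θ}` is abelian, and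
`reflY` exchanges `e₃` and `-e₃` while inverting `T`. Inversion combined with the sign on `ℝ` acts
by `-1` on `ℝ`, by `(-1)(-1) = 1` on `ℝ ⊗ T` and by `-1` on `ℝ ⊗ Λ²T`. So only degree 1 survives,
and `ℝ ⊗ T = ℝ ⊗ T/{±1} = ℝ ⊗ ℝ/ℤ` through `θ/π`.

The argument is carried out on cocycles with values in `Hom(M, V)`, where `V` is chains modulo
boundaries and the cocycle is tautological. In degree 2 the commutator pairing `f a b - f b a` on
`T` is bimultiplicative and equal to its own negative (`symmetric_of_inverting`). The cocycle thus
defines an abelian extension by the divisible group `Hom(ℝ, V)`, which splits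
(`symmetric_cocycle_eq_coboundary`). The splitting spreads over the sphere
(`eq_coboundary_of_stabilizer`) and is averaged over `±u`. In degree 1,
`one_cocycle_eq_add_angleCochain` shows that the angle cochain is universal up to coboundaries. -/

section Extension

/-! ### Symmetric cocycles and abelian extensions. -/

variable {T W : Type*} [CommGroup T] [AddCommGroup W]

/-- The underlying set of the extension of `T` by `W` defined by a `2`-cocycle `f`. -/
@[ext]
structure CocycleExtension (f : T → T → W) where
  fst : W
  snd : T

/-- The extension of an abelian group by a symmetric `2`-cocycle is an abelian group. -/
abbrev CocycleExtension.addCommGroup (f : T → T → W)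
    (hf : ∀ a b c, f b c - f (a * b) c + f a (b * c) - f a b = 0)
    (hs : ∀ a b, f a b = f b a) : AddCommGroup (CocycleExtension f) :=
  have h1 : ∀ b, f 1 b = f 1 1 := fun b => by
    have := hf 1 1 b
    simp only [one_mul] at this
    rw [sub_self, zero_add] at this
    exact sub_eq_zero.1 this
  letI : Add (CocycleExtension f) := ⟨fun x y => ⟨x.1 + y.1 + f x.2 y.2, x.2 * y.2⟩⟩
  -- The cocycle is not normalized, so the neutral element carries the correction `-f 1 1`.
  letI : Zero (CocycleExtension f) := ⟨⟨-f 1 1, 1⟩⟩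
  letI : Neg (CocycleExtension f) := ⟨fun x => ⟨-x.1 - f x.2⁻¹ x.2 - f 1 1, x.2⁻¹⟩⟩
  { AddGroup.ofLeftAxioms
      (fun x y z => by
        refine CocycleExtension.ext ?_ (mul_assoc _ _ _)
        change x.1 + y.1 + f x.2 y.2 + z.1 + f (x.2 * y.2) z.2
          = x.1 + (y.1 + z.1 + f y.2 z.2) + f x.2 (y.2 * z.2)
        rw [← sub_eq_zero, ← neg_eq_zero, ← hf x.2 y.2 z.2]
        abel)
      (fun x => by
        refine CocycleExtension.ext ?_ (one_mul _)
        change -f 1 1 + x.1 + f 1 x.2 = x.1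
        rw [h1 x.2]
        abel)
      (fun x => by
        refine CocycleExtension.ext ?_ (inv_mul_cancel _)
        change -x.1 - f x.2⁻¹ x.2 - f 1 1 + x.1 + f x.2⁻¹ x.2 = -f 1 1
        abel) with
    add_comm := fun x y => by
      refine CocycleExtension.ext ?_ (mul_comm _ _)
      change x.1 + y.1 + f x.2 y.2 = y.1 + x.1 + f y.2 x.2
      rw [hs, add_comm x.1] }

/-- A symmetric `2`-cocycle on an abelian group with values in a divisible group is a coboundary. -/
theorem symmetric_cocycle_eq_coboundary [DivisibleBy W ℤ] (f : T → T → W)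
    (hf : ∀ a b c, f b c - f (a * b) c + f a (b * c) - f a b = 0)
    (hs : ∀ a b, f a b = f b a) :
    ∃ μ : T → W, ∀ a b, f a b = μ b - μ (a * b) + μ a := by
  let := CocycleExtension.addCommGroup f hf hs
  have h1 : ∀ b, f 1 b = f 1 1 := fun b => by
    have := hf 1 1 b
    simp only [one_mul] at this
    rw [sub_self, zero_add] at this
    exact sub_eq_zero.1 this
  let i : W →+ CocycleExtension f := AddMonoidHom.mk' (fun w => ⟨w - f 1 1, 1⟩) fun a b => by
    refine CocycleExtension.ext ?_ (one_mul _).symm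
    change a + b - f 1 1 = a - f 1 1 + (b - f 1 1) + f 1 1
    abel
  have hi : Function.Injective i := fun a b h => by
    have := congrArg CocycleExtension.fst h
    exact sub_left_injective this
  -- Divisible groups are injective: the identity of `W` extends to a retraction `ρ` of the
  -- extension, and `μ` is `ρ` on the set-theoretic section `a ↦ (0, a)`.
  obtain ⟨ρ, hρ⟩ := (Module.Baer.of_divisible W).extension_property_addMonoidHom i hi
    (AddMonoidHom.id W)
  refine ⟨fun a => ρ ⟨0, a⟩, fun a b => ?_⟩
  have key : (⟨0, a⟩ : CocycleExtension f) + ⟨0, b⟩ = i (f a b) + ⟨0, a * b⟩ := by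
    refine CocycleExtension.ext ?_ (one_mul _).symm
    change 0 + 0 + f a b = f a b - f 1 1 + 0 + f 1 (a * b)
    rw [h1 (a * b)]
    abel
  have h := congrArg ρ key
  rw [map_add, map_add, show ρ (i (f a b)) = f a b from DFunLike.congr_fun hρ (f a b)] at h
  rw [add_comm (_ - _), ← add_sub_assoc, h]
  abel

end Extension

/-! ### Cocycles on the action groupoid. -/

section ActionCocycle

variable {G X W : Type*} [Group G] [MulAction G X] [AddCommGroup W]

/-- A `2`-cocycle on the action groupoid of `G` on `X` with values in `W`. -/
def IsActionCocycle (f : G → G → X → W) : Prop :=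
  -- The pair `(g, x)` is the arrow from `g⁻¹ • x` to `x`.
  ∀ g h k x, f h k (g⁻¹ • x) - f (g * h) k x + f g (h * k) x - f g h x = 0

variable {f : G → G → X → W}

/-- A `2`-cocycle on the action groupoid is transported along a commutative diagram of arrows
`g, h` and `a, b` connected by arrows `p, q, r`, up to a coboundary. -/
theorem IsActionCocycle.transport (hf : IsActionCocycle f) {g h a b p q r : G} {x : X}
    (hg : g * q = p * a) (hh : h * r = q * b) :
    f g h x - f a b (p⁻¹ • x) =
      (f h r (g⁻¹ • x) - f q b (g⁻¹ • x)) - (f (g * h) r x - f p (a * b) x)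
        + (f g q x - f p a x) := by
  have h1 := hf g h r x
  have h2 := hf g q b x
  have h3 := hf p a b x
  rw [hh] at h1
  rw [hg] at h2
  rw [← sub_eq_zero] at h1 h2 h3 ⊢
  rw [← sub_eq_zero.2 (congrArg₂ (· - ·) (congrArg₂ (· - ·) h2 h1) h3)]
  abel

/-- A `2`-cocycle on the action groupoid of a transitive action is a coboundary if its restriction
to a stabilizer is one. -/
theorem IsActionCocycle.eq_coboundary_of_stabilizer (hf : IsActionCocycle f) {x₀ : X} {s : X → G}
    (hs : ∀ x, s x • x₀ = x) {μ : G → W}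
    (hμ : ∀ a ∈ MulAction.stabilizer G x₀, ∀ b ∈ MulAction.stabilizer G x₀,
      f a b x₀ = μ b - μ (a * b) + μ a) :
    ∃ ν : G → X → W, ∀ g h x, f g h x = ν h (g⁻¹ • x) - ν (g * h) x + ν g x := by
  have hs' : ∀ x, (s x)⁻¹ • x = x₀ := fun x => by rw [inv_smul_eq_iff, hs]
  -- Arrows are retracted to loops at `x₀` along the chosen paths `s`; the correction in `ν` comes
  -- from `transport` along these paths.
  let κ : G → X → G := fun g x => (s x)⁻¹ * g * s (g⁻¹ • x)
  have hκ : ∀ g x, κ g x ∈ MulAction.stabilizer G x₀ := fun g x => by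
    rw [MulAction.mem_stabilizer_iff]
    simp only [κ, mul_smul, hs, smul_inv_smul, hs']
  refine ⟨fun g x => f g (s (g⁻¹ • x)) x - f (s x) (κ g x) x + μ (κ g x), fun g h x => ?_⟩
  have hmul : κ g x * κ h (g⁻¹ • x) = κ (g * h) x := by
    simp only [κ, mul_inv_rev, mul_smul]
    group
  have h1 := hf.transport (g := g) (h := h) (a := κ g x) (b := κ h (g⁻¹ • x)) (p := s x)
    (q := s (g⁻¹ • x)) (r := s (h⁻¹ • g⁻¹ • x)) (x := x) (by simp only [κ]; group)
    (by simp only [κ]; group)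
  rw [hs', hμ _ (hκ _ _) _ (hκ _ _), hmul, sub_eq_iff_eq_add] at h1
  rw [h1]
  simp only [mul_inv_rev, mul_smul]
  abel

/-- If an element `σ` inverts the abelian stabilizer of `x₀` and the cocycle is odd between
`x₀` and `σ • x₀`, then the cocycle is symmetric on the stabilizer. -/
theorem IsActionCocycle.symmetric_of_inverting (hf : IsActionCocycle f) {x₀ : X}
    (hW : ∀ w : W, w + w = 0 → w = 0)
    (hcomm : ∀ a ∈ MulAction.stabilizer G x₀, ∀ b ∈ MulAction.stabilizer G x₀, a * b = b * a)
    {σ : G} (hσ : ∀ a ∈ MulAction.stabilizer G x₀, a⁻¹ * σ = σ * a)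
    (hodd : ∀ g h, f g h (σ • x₀) = -f g h x₀)
    {a b : G} (ha : a ∈ MulAction.stabilizer G x₀) (hb : b ∈ MulAction.stabilizer G x₀) :
    f a b x₀ = f b a x₀ := by
  set T := MulAction.stabilizer G x₀
  have hinv : ∀ {t : G}, t ∈ T → t⁻¹ • x₀ = x₀ := fun ht => T.inv_mem ht
  -- The antisymmetrization of a cocycle on an abelian group is multiplicative in its first
  -- variable.
  have hbi : ∀ a ∈ T, ∀ b ∈ T, ∀ c ∈ T, f (a * b) c x₀ - f c (a * b) x₀ =
      (f a c x₀ - f c a x₀) + (f b c x₀ - f c b x₀) := fun a ha b hb c hc => by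
    have h1 := hf a b c x₀
    have h2 := hf c a b x₀
    have h3 := hf a c b x₀
    rw [hinv ha] at h1 h3
    rw [hinv hc] at h2
    rw [hcomm c hc b hb] at h3
    rw [hcomm c hc a ha] at h2
    rw [← sub_eq_zero] at h1 h2 h3 ⊢
    rw [← sub_eq_zero.2 (congrArg₂ (· - ·) (congrArg₂ (· - ·) h3 h2) h1)]
    abel
  have h1T : (1 : G) ∈ T := T.one_mem
  have hone : ∀ c ∈ T, f 1 c x₀ - f c 1 x₀ = 0 := fun c hc => by
    have := hbi 1 h1T 1 h1T c hc
    rw [mul_one] at this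
    exact left_eq_add.1 this
  have hneg : ∀ a ∈ T, ∀ c ∈ T, f a⁻¹ c x₀ - f c a⁻¹ x₀ = -(f a c x₀ - f c a x₀) :=
    fun a ha c hc => by
      have := hbi a ha a⁻¹ (T.inv_mem ha) c hc
      rw [mul_inv_cancel, hone c hc] at this
      exact (neg_eq_of_add_eq_zero_right this.symm).symm
  have hσinv : ∀ a ∈ T, a⁻¹⁻¹ • σ • x₀ = σ • x₀ := fun a ha => by
    have := hσ a⁻¹ (T.inv_mem ha)
    rw [← mul_smul, this, mul_smul, hinv ha]
  -- Transport along `σ` changes `f` by a term symmetric in `a` and `b`. Hence the pairing of `a⁻¹,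
  -- b⁻¹` at `σ • x₀` equals that of `a, b` at `x₀`; oddness makes it also the negative, so twice
  -- the pairing is zero.
  have h1 := hf.transport (g := a⁻¹) (h := b⁻¹) (a := a) (b := b) (p := σ) (q := σ) (r := σ)
    (x := σ • x₀) (hσ a ha) (hσ b hb)
  have h2 := hf.transport (g := b⁻¹) (h := a⁻¹) (a := b) (b := a) (p := σ) (q := σ) (r := σ)
    (x := σ • x₀) (hσ b hb) (hσ a ha)
  rw [hσinv a ha, inv_smul_smul, hcomm a⁻¹ (T.inv_mem ha) b⁻¹ (T.inv_mem hb),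
    hcomm a ha b hb] at h1
  rw [hσinv b hb, inv_smul_smul] at h2
  have h3 := hneg a ha b⁻¹ (T.inv_mem hb)
  have h4 := hneg b hb a ha
  rw [hodd] at h1 h2
  refine sub_eq_zero.1 (hW _ ?_)
  have h5 := sub_eq_zero.2 (congrArg₂ (· - ·) h1 h2)
  rw [← sub_eq_zero] at h3 h4
  rw [← neg_eq_zero, ← sub_eq_zero.2 (congrArg₂ (· + ·) (congrArg₂ (· + ·) h3 h4) h5)]
  abel

/-- Under the hypotheses of `symmetric_of_inverting`, an action `2`-cocycle of a transitive
action with divisible values is a coboundary. -/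
theorem IsActionCocycle.eq_coboundary [DivisibleBy W ℤ] (hf : IsActionCocycle f) {x₀ : X}
    {s : X → G} (hs : ∀ x, s x • x₀ = x) (hW : ∀ w : W, w + w = 0 → w = 0)
    (hcomm : ∀ a ∈ MulAction.stabilizer G x₀, ∀ b ∈ MulAction.stabilizer G x₀, a * b = b * a)
    {σ : G} (hσ : ∀ a ∈ MulAction.stabilizer G x₀, a⁻¹ * σ = σ * a)
    (hodd : ∀ g h, f g h (σ • x₀) = -f g h x₀) :
    ∃ ν : G → X → W, ∀ g h x, f g h x = ν h (g⁻¹ • x) - ν (g * h) x + ν g x := by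
  let : CommGroup (MulAction.stabilizer G x₀) :=
    { (inferInstance : Group (MulAction.stabilizer G x₀)) with
      mul_comm := fun a b => Subtype.ext (hcomm a a.2 b b.2) }
  obtain ⟨μ, hμ⟩ := symmetric_cocycle_eq_coboundary
    (fun a b : MulAction.stabilizer G x₀ => f a b x₀)
    (fun a b c => by
      have := hf a b c x₀
      rwa [show (a : G)⁻¹ • x₀ = x₀ from (MulAction.stabilizer G x₀).inv_mem a.2] at this)
    (fun a b => hf.symmetric_of_inverting hW hcomm hσ hodd a.2 b.2)
  classical
  refine hf.eq_coboundary_of_stabilizer hs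
    -- The value off the stabilizer is never used.
    (μ := fun g => if h : g ∈ MulAction.stabilizer G x₀ then μ ⟨g, h⟩ else 0)
    fun a ha b hb => ?_
  simp only [dif_pos ha, dif_pos hb, dif_pos (mul_mem ha hb)]
  exact hμ ⟨a, ha⟩ ⟨b, hb⟩

end ActionCocycle

/-! ### Divisibility and absence of 2-torsion in `Hom(ℝ, V)`. -/

/-- Homomorphisms out of the real numbers form a divisible group. -/
noncomputable instance realHomDivisibleBy (V : Type*) [AddCommGroup V] :
    DivisibleBy (ℝ →+ V) ℤ where
  -- Division takes place in the argument, so `V` may be arbitrary.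
  div w n := w.comp (AddMonoidHom.mulRight ((n : ℝ)⁻¹))
  div_zero w := by ext; simp
  div_cancel {n} w hn := by
    ext x
    have hn' : (n : ℝ) ≠ 0 := Int.cast_ne_zero.2 hn
    rw [AddMonoidHom.coe_smul, Pi.smul_apply, AddMonoidHom.comp_apply, ← map_zsmul]
    congr 1
    simp only [AddMonoidHom.coe_mulRight, zsmul_eq_mul]
    field_simp

theorem realHom_eq_zero_of_add_self {V : Type*} [AddCommGroup V] (w : ℝ →+ V)
    (h : w + w = 0) : w = 0 := by
  ext x
  have := DFunLike.congr_fun h (x / 2)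
  rwa [AddMonoidHom.add_apply, ← map_add, add_halves] at this

/-! ### The twisted action on the sphere and the stabilizer of `e₃`. -/

noncomputable section

namespace O3

theorem transpose_mul_self (g : O3) : g.1ᵀ * g.1 = 1 :=
  (Matrix.mem_orthogonalGroup_iff' (Fin 3) ℝ).1 g.2

theorem mul_transpose_self (g : O3) : g.1 * g.1ᵀ = 1 :=
  (Matrix.mem_orthogonalGroup_iff (Fin 3) ℝ).1 g.2

theorem det_mul_det (g : O3) : g.1.det * g.1.det = 1 := by
  have := congrArg Matrix.det (mul_transpose_self g)
  rwa [Matrix.det_mul, Matrix.det_transpose, Matrix.det_one] at this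

theorem dotProduct_mulVec_mulVec (g : O3) (v w : Fin 3 → ℝ) :
    (g.1 *ᵥ v) ⬝ᵥ (g.1 *ᵥ w) = v ⬝ᵥ w := by
  rw [Matrix.dotProduct_mulVec, Matrix.vecMul_mulVec, transpose_mul_self, Matrix.vecMul_one]

/-- Pairing with an arbitrary vector reduces this to multiplicativity of the determinant. The factor
`det g` is the one in the twisted action, so that action respects the sense of rotation about an
axis. -/
theorem cross_mulVec_mulVec (g : O3) (v w : Fin 3 → ℝ) :
    (g.1 *ᵥ v) ⨯₃ (g.1 *ᵥ w) = g.1.det • (g.1 *ᵥ (v ⨯₃ w)) := by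
  refine dotProduct_eq _ _ fun z => ?_
  obtain ⟨z, rfl⟩ : ∃ z', g.1 *ᵥ z' = z :=
    ⟨g.1ᵀ *ᵥ z, by rw [Matrix.mulVec_mulVec, mul_transpose_self, Matrix.one_mulVec]⟩
  rw [dotProduct_comm, dotProduct_comm _ (g.1 *ᵥ z), dotProduct_smul, dotProduct_mulVec_mulVec,
    triple_product_eq_det, triple_product_eq_det]
  have : Matrix.of ![g.1 *ᵥ z, g.1 *ᵥ v, g.1 *ᵥ w] = Matrix.of ![z, v, w] * g.1ᵀ := by
    ext i j
    fin_cases i <;> simp [Matrix.mul_apply, Matrix.mulVec, dotProduct, mul_comm]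
  refine (congrArg Matrix.det this).trans ?_
  rw [Matrix.det_mul, Matrix.det_transpose, smul_eq_mul, mul_comm]
  rfl

end O3

/-- The unit sphere of `ℝ³`. -/
@[ext]
structure UnitVector where
  val : Fin 3 → ℝ
  dot_self : val ⬝ᵥ val = 1

namespace UnitVector

/-- The twisted action `g • w = det(g) g w` of `O(3)` on unit vectors. -/
instance : MulAction O3 UnitVector where
  smul g w := ⟨g.1.det • (g.1 *ᵥ w.val), by
    rw [smul_dotProduct, dotProduct_smul, O3.dotProduct_mulVec_mulVec, w.dot_self,
      smul_eq_mul, smul_eq_mul, mul_one, O3.det_mul_det]⟩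
  one_smul w := by
    refine UnitVector.ext ?_
    change (1 : O3).1.det • ((1 : O3).1 *ᵥ w.val) = w.val
    simp
  mul_smul g h w := by
    refine UnitVector.ext ?_
    change (g * h).1.det • ((g * h).1 *ᵥ w.val) = g.1.det • (g.1 *ᵥ (h.1.det • (h.1 *ᵥ w.val)))
    simp [Matrix.mulVec_smul, smul_smul]

theorem smul_val (g : O3) (w : UnitVector) : (g • w).val = g.1.det • (g.1 *ᵥ w.val) := rfl

instance : Neg UnitVector := ⟨fun w => ⟨-w.val, by simpa using w.dot_self⟩⟩

theorem neg_val (w : UnitVector) : (-w).val = -w.val := rfl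

protected theorem neg_neg (w : UnitVector) : - -w = w := UnitVector.ext (neg_neg w.val)

theorem smul_neg (g : O3) (w : UnitVector) : g • (-w) = -(g • w) :=
  UnitVector.ext (by simp [smul_val, neg_val, Matrix.mulVec_neg])

/-- The third vector of the standard basis. -/
def e₃ : UnitVector := ⟨![0, 0, 1], by simp⟩

end UnitVector

open UnitVector

/-- The rotation by the angle `θ` about the third axis. -/
def rotZ (θ : ℝ) : O3 :=
  ⟨!![Real.cos θ, -Real.sin θ, 0; Real.sin θ, Real.cos θ, 0; 0, 0, 1], by
    rw [Matrix.mem_orthogonalGroup_iff]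
    ext i j
    fin_cases i <;> fin_cases j <;>
      simp [Matrix.mul_apply, Fin.sum_univ_three] <;>
      nlinarith [Real.sin_sq_add_cos_sq θ]⟩

/-- A reflection in a plane containing the third axis. -/
def reflY : O3 :=
  ⟨!![1, 0, 0; 0, -1, 0; 0, 0, 1], by
    rw [Matrix.mem_orthogonalGroup_iff]
    ext i j
    fin_cases i <;> fin_cases j <;> simp [Matrix.mul_apply, Fin.sum_univ_three]⟩

theorem rotZ_det (θ : ℝ) : (rotZ θ).1.det = 1 := by
  simp only [rotZ, Matrix.det_fin_three]
  simp
  nlinarith [Real.sin_sq_add_cos_sq θ]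

theorem reflY_det : reflY.1.det = -1 := by
  simp [reflY, Matrix.det_fin_three]

theorem O3.neg_val (g : O3) : (-g).1 = -g.1 := rfl

theorem O3.neg_det (g : O3) : (-g).1.det = -g.1.det := by
  rw [O3.neg_val, Matrix.det_neg, Fintype.card_fin]
  ring

theorem O3.neg_smul (g : O3) (w : UnitVector) : (-g) • w = g • w :=
  UnitVector.ext (by
    rw [smul_val, smul_val, O3.neg_det, O3.neg_val, Matrix.neg_mulVec, _root_.smul_neg,
      _root_.neg_smul, neg_neg])

theorem rotZ_add (θ φ : ℝ) : rotZ (θ + φ) = rotZ θ * rotZ φ := by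
  refine Subtype.ext (Matrix.ext fun i j => ?_)
  change _ = ((rotZ θ).1 * (rotZ φ).1) i j
  fin_cases i <;> fin_cases j <;>
    simp [rotZ, Matrix.mul_apply, Fin.sum_univ_three, Real.cos_add, Real.sin_add] <;> ring

theorem rotZ_zero : rotZ 0 = 1 := by
  refine Subtype.ext (Matrix.ext fun i j => ?_)
  fin_cases i <;> fin_cases j <;> simp [rotZ]

theorem rotZ_inv (θ : ℝ) : (rotZ θ)⁻¹ = rotZ (-θ) := by
  rw [inv_eq_iff_mul_eq_one, ← rotZ_add, add_neg_cancel, rotZ_zero]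

theorem rotZ_two_pi : rotZ (2 * Real.pi) = 1 := by
  rw [← rotZ_zero]
  simp [rotZ]

theorem rotZ_smul_e₃ (θ : ℝ) : rotZ θ • e₃ = e₃ := by
  refine UnitVector.ext ?_
  rw [smul_val, rotZ_det]
  ext i
  fin_cases i <;> simp [rotZ, e₃]

theorem reflY_smul_e₃ : reflY • e₃ = -e₃ := by
  refine UnitVector.ext ?_
  rw [smul_val, reflY_det]
  ext i
  fin_cases i <;> simp [reflY, e₃, UnitVector.neg_val]

theorem rotZ_neg_mul_reflY (θ : ℝ) : rotZ (-θ) * reflY = reflY * rotZ θ := by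
  refine Subtype.ext (Matrix.ext fun i j => ?_)
  change ((rotZ (-θ)).1 * reflY.1) i j = (reflY.1 * (rotZ θ).1) i j
  fin_cases i <;> fin_cases j <;> simp [rotZ, reflY, Matrix.mul_apply, Fin.sum_univ_three]

theorem isRotationAbout_rotZ (θ : ℝ) : IsRotationAbout e₃.val θ (rotZ θ) := by
  intro x
  ext i
  fin_cases i <;> simp [rotZ, e₃, cross_apply, dotProduct, Matrix.mulVec, Fin.sum_univ_three,
    Matrix.vecHead, Matrix.vecTail] <;> ring

theorem exists_cos_sin {a c : ℝ} (h : a * a + c * c = 1) :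
    ∃ θ : ℝ, a = Real.cos θ ∧ c = Real.sin θ := by
  have hn : ‖(⟨a, c⟩ : ℂ)‖ = 1 := by
    rw [Complex.norm_def, Complex.normSq_mk, h, Real.sqrt_one]
  have h0 : (⟨a, c⟩ : ℂ) ≠ 0 := by
    rw [← norm_ne_zero_iff, hn]
    exact one_ne_zero
  refine ⟨Complex.arg ⟨a, c⟩, ?_, ?_⟩
  · rw [Complex.cos_arg h0, hn, div_one]
  · rw [Complex.sin_arg, hn, div_one]

theorem exists_eq_rotZ_of_det_eq_one {g : O3} (hd : g.1.det = 1) (hg : g • e₃ = e₃) :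
    ∃ θ, g = rotZ θ := by
  have hv : g.1 *ᵥ e₃.val = e₃.val := by
    have := congrArg UnitVector.val hg
    rwa [smul_val, hd, one_smul] at this
  -- Since `g` is orthogonal, its transpose also fixes `e₃`, which determines the bottom row.
  have hr : g.1ᵀ *ᵥ e₃.val = e₃.val := by
    conv_lhs => rw [← hv]
    rw [Matrix.mulVec_mulVec, O3.transpose_mul_self, Matrix.one_mulVec]
  have h02 : g.1 0 2 = 0 := by simpa [e₃, Matrix.mulVec, dotProduct, Fin.sum_univ_three] using congrFun hv 0
  have h12 : g.1 1 2 = 0 := by simpa [e₃, Matrix.mulVec, dotProduct, Fin.sum_univ_three] using congrFun hv 1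
  have h22 : g.1 2 2 = 1 := by simpa [e₃, Matrix.mulVec, dotProduct, Fin.sum_univ_three] using congrFun hv 2
  have h20 : g.1 2 0 = 0 := by simpa [e₃, Matrix.mulVec, dotProduct, Fin.sum_univ_three] using congrFun hr 0
  have h21 : g.1 2 1 = 0 := by simpa [e₃, Matrix.mulVec, dotProduct, Fin.sum_univ_three] using congrFun hr 1
  have h00 := congrFun (congrFun (O3.transpose_mul_self g) 0) 0
  have h11 := congrFun (congrFun (O3.transpose_mul_self g) 1) 1
  simp only [Matrix.mul_apply, Fin.sum_univ_three, Matrix.transpose_apply, h20, h21,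
    Matrix.one_apply_eq, mul_zero, add_zero] at h00 h11
  rw [Matrix.det_fin_three, h02, h12, h22, h20, h21] at hd
  obtain ⟨θ, hc, hs⟩ := exists_cos_sin h00
  have hsum : (g.1 0 0 - g.1 1 1) ^ 2 + (g.1 0 1 + g.1 1 0) ^ 2 = 0 := by
    linear_combination h00 + h11 - 2 * hd
  have hA : g.1 1 1 = g.1 0 0 := by
    nlinarith [sq_nonneg (g.1 0 0 - g.1 1 1), sq_nonneg (g.1 0 1 + g.1 1 0)]
  have hB : g.1 0 1 = -g.1 1 0 := by
    nlinarith [sq_nonneg (g.1 0 0 - g.1 1 1), sq_nonneg (g.1 0 1 + g.1 1 0)]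
  refine ⟨θ, Subtype.ext (Matrix.ext fun i j => ?_)⟩
  fin_cases i <;> fin_cases j <;> simp [rotZ, h02, h12, h22, h20, h21, hA, hB, ← hc, ← hs]

/-- The scalar `-1` acts trivially under the twisted action, so determinant `-1` reduces to
determinant `1`. -/
theorem exists_eq_rotZ_or_neg {g : O3} (hg : g ∈ MulAction.stabilizer O3 e₃) :
    ∃ θ, g = rotZ θ ∨ g = -rotZ θ := by
  rcases mul_self_eq_one_iff.1 (O3.det_mul_det g) with hd | hd
  · obtain ⟨θ, h⟩ := exists_eq_rotZ_of_det_eq_one hd hg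
    exact ⟨θ, Or.inl h⟩
  · obtain ⟨θ, h⟩ := exists_eq_rotZ_of_det_eq_one (g := -g) (by rw [O3.neg_det, hd, neg_neg])
      ((O3.neg_smul g e₃).trans hg)
    exact ⟨θ, Or.inr (by rw [← h, neg_neg])⟩

theorem stabilizer_e₃_comm {a b : O3} (ha : a ∈ MulAction.stabilizer O3 e₃)
    (hb : b ∈ MulAction.stabilizer O3 e₃) : a * b = b * a := by
  obtain ⟨θ, rfl | rfl⟩ := exists_eq_rotZ_or_neg ha <;>
  obtain ⟨φ, rfl | rfl⟩ := exists_eq_rotZ_or_neg hb <;>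
  simp only [neg_mul, mul_neg, ← rotZ_add, add_comm]

theorem inv_mul_reflY {a : O3} (ha : a ∈ MulAction.stabilizer O3 e₃) :
    a⁻¹ * reflY = reflY * a := by
  obtain ⟨θ, rfl | rfl⟩ := exists_eq_rotZ_or_neg ha
  · rw [rotZ_inv, rotZ_neg_mul_reflY]
  · have : (-rotZ θ)⁻¹ = -rotZ (-θ) := by
      rw [inv_eq_iff_mul_eq_one, neg_mul_neg, ← rotZ_add, add_neg_cancel, rotZ_zero]
    rw [this, neg_mul, rotZ_neg_mul_reflY, mul_neg]

/-- The invariant `θ / π mod 1` of `± rotZ θ`. -/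
def axisAngle (g : O3) : AddCircle (1 : ℝ) :=
  ((Complex.arg ⟨g.1 0 0, g.1 1 0⟩ / Real.pi : ℝ) : AddCircle (1 : ℝ))

theorem axisAngle_eq {g : O3} {θ : ℝ} (hc : g.1 0 0 = Real.cos θ) (hs : g.1 1 0 = Real.sin θ) :
    axisAngle g = ((θ / Real.pi : ℝ) : AddCircle (1 : ℝ)) := by
  have h := Complex.arg_cos_add_sin_mul_I_coe_angle (θ : Real.Angle)
  have hz : (⟨g.1 0 0, g.1 1 0⟩ : ℂ) = (Real.cos θ : ℂ) + (Real.sin θ : ℂ) * Complex.I := by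
    rw [hc, hs, Complex.mk_eq_add_mul_I]
  rw [Real.Angle.cos_coe, Real.Angle.sin_coe, ← hz, Real.Angle.angle_eq_iff_two_pi_dvd_sub] at h
  obtain ⟨k, hk⟩ := h
  rw [axisAngle, ← sub_eq_zero, ← AddCircle.coe_sub, AddCircle.coe_eq_zero_iff, ← sub_div, hk]
  refine ⟨2 * k, ?_⟩
  have := Real.pi_ne_zero
  push_cast [zsmul_eq_mul]
  field_simp

theorem axisAngle_rotZ (θ : ℝ) : axisAngle (rotZ θ) = ((θ / Real.pi : ℝ) : AddCircle (1 : ℝ)) :=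
  axisAngle_eq (by simp [rotZ]) (by simp [rotZ])

/-- A sign shifts `θ` by `π`, a full period of `θ/π`; this is why the normalization is not `θ/(2π)`.
-/
theorem axisAngle_neg_rotZ (θ : ℝ) :
    axisAngle (-rotZ θ) = ((θ / Real.pi : ℝ) : AddCircle (1 : ℝ)) := by
  rw [axisAngle_eq (θ := θ + Real.pi) (by simp [rotZ, O3.neg_val]) (by simp [rotZ, O3.neg_val]),
    add_div, div_self Real.pi_ne_zero, AddCircle.coe_add, AddCircle.coe_period, add_zero]

theorem axisAngle_mul {a b : O3} (ha : a ∈ MulAction.stabilizer O3 e₃)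
    (hb : b ∈ MulAction.stabilizer O3 e₃) : axisAngle (a * b) = axisAngle a + axisAngle b := by
  obtain ⟨θ, rfl | rfl⟩ := exists_eq_rotZ_or_neg ha <;>
  obtain ⟨φ, rfl | rfl⟩ := exists_eq_rotZ_or_neg hb <;>
  simp only [neg_mul, mul_neg, neg_neg, ← rotZ_add, axisAngle_rotZ, axisAngle_neg_rotZ, add_div,
    AddCircle.coe_add]

theorem exists_mulVec_e₃ (w : UnitVector) : ∃ s : O3, s.1 *ᵥ e₃.val = w.val := by
  obtain ⟨w, hw⟩ := w
  rw [dotProduct, Fin.sum_univ_three] at hw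
  by_cases h : 1 + w 2 = 0
  · have h2 : w 2 = -1 := by linarith
    rw [h2] at hw
    have h0 : w 0 = 0 := by nlinarith [mul_self_nonneg (w 0), mul_self_nonneg (w 1)]
    have h1 : w 1 = 0 := by nlinarith [mul_self_nonneg (w 0), mul_self_nonneg (w 1)]
    refine ⟨-1, ?_⟩
    ext i
    fin_cases i <;> simp [O3.neg_val, Matrix.neg_mulVec, e₃, h0, h1, h2]
  -- The half-turn about the bisector `n = e₃ + w` exchanges `e₃` and `w`; its matrix is `(2/|n|²) n
  -- nᵀ - 1`, and `|n|² = 2(1 + w 2)`.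
  · set n : Fin 3 → ℝ := ![w 0, w 1, 1 + w 2] with hn
    set k : ℝ := (1 + w 2)⁻¹
    have hk : k * (1 + w 2) = 1 := inv_mul_cancel₀ h
    have hnn : n ⬝ᵥ n = 2 * (1 + w 2) := by
      simp only [hn, dotProduct, Fin.sum_univ_three, Matrix.cons_val]
      linarith
    refine ⟨⟨k • Matrix.vecMulVec n n - 1, ?_⟩, ?_⟩
    · rw [Matrix.mem_orthogonalGroup_iff, Matrix.transpose_sub, Matrix.transpose_smul,
        Matrix.transpose_vecMulVec, Matrix.transpose_one, sub_mul, mul_sub, mul_one, one_mul,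
        smul_mul_smul_comm, Matrix.vecMulVec_mul_vecMulVec, hnn, Matrix.vecMulVec_smul, smul_smul,
        show k * k * (2 * (1 + w 2)) = 2 * k by linear_combination 2 * k * hk]
      module
    · change (k • Matrix.vecMulVec n n - 1) *ᵥ e₃.val = w
      ext i
      fin_cases i <;> simp [Matrix.mulVec, dotProduct, Fin.sum_univ_three, e₃, hn] <;>
        first
        | linear_combination (w 0) * hk
        | linear_combination (w 1) * hk
        | linear_combination (1 + w 2) * hk

theorem exists_smul_e₃ (w : UnitVector) : ∃ s : O3, s • e₃ = w := by
  obtain ⟨s, hs⟩ := exists_mulVec_e₃ w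
  rcases mul_self_eq_one_iff.1 (O3.det_mul_det s) with hd | hd
  · exact ⟨s, UnitVector.ext (by rw [smul_val, hd, one_smul, hs])⟩
  · have he : reflY.1 *ᵥ e₃.val = e₃.val := by
      ext i
      fin_cases i <;> simp [reflY, e₃]
    have hd' : (s * reflY).1.det = 1 := by
      change (s.1 * reflY.1).det = 1
      rw [Matrix.det_mul, hd, reflY_det, neg_mul_neg, one_mul]
    refine ⟨s * reflY, UnitVector.ext ?_⟩
    rw [smul_val, hd', one_smul]
    change (s.1 * reflY.1) *ᵥ e₃.val = _
    rw [← Matrix.mulVec_mulVec, he, hs]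

/-- An element of `O(3)` carrying the third basis vector to `w` under the twisted action. -/
def moveE₃ (w : UnitVector) : O3 := (exists_smul_e₃ w).choose

theorem moveE₃_smul (w : UnitVector) : moveE₃ w • e₃ = w := (exists_smul_e₃ w).choose_spec

theorem moveE₃_inv_smul (w : UnitVector) : (moveE₃ w)⁻¹ • w = e₃ := by
  rw [inv_smul_eq_iff, moveE₃_smul]

/-- Rodrigues' formula is equivariant: the twist of the axis cancels the determinant in the cross
product, and the last term is quadratic in the axis. -/
theorem IsRotationAbout.conj_eq_rotZ {w : UnitVector} {θ : ℝ} {g : O3}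
    (h : IsRotationAbout w.val θ g) {s : O3} (hs : s • e₃ = w) : s⁻¹ * g * s = rotZ θ := by
  rw [mul_assoc, inv_mul_eq_iff_eq_mul]
  refine Subtype.ext (Matrix.ext_of_mulVec_single fun i => ?_)
  generalize (Pi.single i 1 : Fin 3 → ℝ) = x
  change (g.1 * s.1) *ᵥ x = (s.1 * (rotZ θ).1) *ᵥ x
  rw [← Matrix.mulVec_mulVec, ← Matrix.mulVec_mulVec, h, isRotationAbout_rotZ, ← hs, smul_val,
    map_smul, LinearMap.smul_apply, O3.cross_mulVec_mulVec, smul_dotProduct,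
    O3.dotProduct_mulVec_mulVec]
  have hd := O3.det_mul_det s
  simp only [Matrix.mulVec_add, Matrix.mulVec_smul, smul_smul, hd, one_smul, smul_eq_mul]
  congr 2
  linear_combination ((1 - Real.cos θ) * (e₃.val ⬝ᵥ x)) * hd

theorem IsRotationAbout.neg {w : UnitVector} {θ : ℝ} {g : O3}
    (h : IsRotationAbout w.val θ g) : IsRotationAbout (-w).val (-θ) g := by
  intro x
  rw [h x, UnitVector.neg_val, map_neg, LinearMap.neg_apply, Real.cos_neg, Real.sin_neg,
    neg_smul_neg, neg_dotProduct, mul_neg, neg_smul_neg]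

theorem IsRotationAbout.smul_eq {w : UnitVector} {θ : ℝ} {g : O3}
    (h : IsRotationAbout w.val θ g) : g • w = w := by
  have := h.conj_eq_rotZ (moveE₃_smul w)
  rw [mul_assoc, inv_mul_eq_iff_eq_mul] at this
  conv_lhs => rw [← moveE₃_smul w]
  rw [← mul_smul, this, mul_smul, rotZ_smul_e₃, moveE₃_smul]

end

/-! ### Lines as unit vectors up to sign. -/

noncomputable section

namespace UnitVector

theorem val_ne_zero (x : UnitVector) : x.val ≠ 0 := fun h => by
  have := x.dot_self
  rw [h, zero_dotProduct] at this
  exact zero_ne_one this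

/-- The line spanned by a unit vector. -/
def line (x : UnitVector) : Line := ⟨Submodule.span ℝ {x.val}, finrank_span_singleton x.val_ne_zero⟩

theorem val_mem_line (x : UnitVector) : x.val ∈ x.line.1 := Submodule.mem_span_singleton_self _

theorem line_eq_of_mem {x : UnitVector} {L : Line} (h : x.val ∈ L.1) : x.line = L := by
  have : FiniteDimensional ℝ L.1 := FiniteDimensional.of_finrank_pos (by rw [L.2]; exact one_pos)
  refine Subtype.ext (Submodule.eq_of_le_of_finrank_eq ?_ (x.line.2.trans L.2.symm))
  exact (Submodule.span_singleton_le_iff_mem _ _).2 h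

/-- The vector `ℓ x` in the summand `ℝ x` of `⨁ L, L`. -/
def axisVector (x : UnitVector) : ℝ →+ LineSum :=
  (DirectSum.of (fun L : Line => L.1) x.line).comp
    (LinearMap.toSpanSingleton ℝ x.line.1 ⟨x.val, x.val_mem_line⟩).toAddMonoidHom

theorem of_eq_axisVector {x : UnitVector} {L : Line} {v : L.1} {t : ℝ}
    (h : (v : Fin 3 → ℝ) = t • x.val) (hx : x.val ∈ L.1) :
    DirectSum.of (fun L : Line => L.1) L v = axisVector x t :=
  LineSum.of_congr (line_eq_of_mem hx).symm _ _ h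

theorem twistedAction_axisVector (g : O3) (x : UnitVector) (t : ℝ) :
    twistedAction g (axisVector x t) = axisVector (g • x) t := by
  refine (twistedAction_of g _ _).trans (of_eq_axisVector ?_ ?_)
  · change g.1.det • (g.1 *ᵥ (t • x.val)) = t • (g • x).val
    rw [smul_val, Matrix.mulVec_smul, smul_comm]
  · exact Submodule.smul_mem _ _ (Line.mulVec_mem_map g x.line ⟨x.val, x.val_mem_line⟩)

theorem axisVector_neg (x : UnitVector) (t : ℝ) : axisVector (-x) t = axisVector x (-t) := by
  refine of_eq_axisVector ?_ ?_
  · change t • (-x).val = (-t) • x.val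
    rw [neg_val, _root_.smul_neg, _root_.neg_smul]
  · rw [← Submodule.neg_mem_iff]
    exact (-x).val_mem_line

theorem exists_mem (L : Line) : ∃ x : UnitVector, x.val ∈ L.1 := by
  obtain ⟨v, hv, -⟩ := finrank_eq_one_iff'.1 L.2
  have h0 : (v : Fin 3 → ℝ) ⬝ᵥ (v : Fin 3 → ℝ) ≠ 0 := fun h =>
    hv (Subtype.ext (dotProduct_self_eq_zero.1 h))
  have h1 : 0 < (v : Fin 3 → ℝ) ⬝ᵥ (v : Fin 3 → ℝ) :=
    lt_of_le_of_ne (Finset.sum_nonneg fun i _ => mul_self_nonneg _) h0.symm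
  refine ⟨⟨(√((v : Fin 3 → ℝ) ⬝ᵥ (v : Fin 3 → ℝ)))⁻¹ • v, ?_⟩, L.1.smul_mem _ v.2⟩
  rw [smul_dotProduct, dotProduct_smul, smul_eq_mul, smul_eq_mul, ← mul_assoc, ← mul_inv,
    Real.mul_self_sqrt h1.le, inv_mul_cancel₀ h0]

theorem eq_smul_of_mem {x : UnitVector} {L : Line} (hx : x.val ∈ L.1) {v : Fin 3 → ℝ}
    (hv : v ∈ L.1) : v = (v ⬝ᵥ x.val) • x.val := by
  rw [← line_eq_of_mem hx] at hv
  obtain ⟨t, rfl⟩ := Submodule.mem_span_singleton.1 hv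
  rw [smul_dotProduct, x.dot_self, smul_eq_mul, mul_one]

theorem eq_or_eq_neg_of_mem {x y : UnitVector} {L : Line} (hx : x.val ∈ L.1) (hy : y.val ∈ L.1) :
    x = y ∨ x = -y := by
  have h := eq_smul_of_mem hy hx
  have h1 := x.dot_self
  rw [h, smul_dotProduct, dotProduct_smul, y.dot_self, smul_eq_mul, smul_eq_mul, mul_one,
    mul_self_eq_one_iff] at h1
  rcases h1 with h1 | h1
  · exact Or.inl (UnitVector.ext (by rw [h, h1, one_smul]))
  · exact Or.inr (UnitVector.ext (by rw [h, h1, _root_.neg_smul, one_smul, neg_val]))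

end UnitVector

open UnitVector

namespace LineSum

theorem addHom_ext_axisVector {A : Type*} [AddCommMonoid A] {F F' : LineSum →+ A}
    (h : ∀ x t, F (axisVector x t) = F' (axisVector x t)) : F = F' := by
  refine DirectSum.addHom_ext fun L v => ?_
  obtain ⟨x, hx⟩ := exists_mem L
  rw [of_eq_axisVector (eq_smul_of_mem hx v.2) hx, h]

/-- A unit vector in a line. -/
def orient (L : Line) : UnitVector := (exists_mem L).choose

theorem orient_mem (L : Line) : (orient L).val ∈ L.1 := (exists_mem L).choose_spec

/-- Half the coordinate on `L` with respect to `orient L`. -/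
def halfCoord (L : Line) : L.1 →+ ℝ :=
  AddMonoidHom.mk' (fun v => (v : Fin 3 → ℝ) ⬝ᵥ (orient L).val / 2) fun v w => by
    rw [Submodule.coe_add, add_dotProduct, add_div]

/-- The map out of `⨁ L, L` obtained by averaging a family of homomorphisms indexed by unit
vectors over the two unit vectors of each line. -/
def average {A : Type*} [AddCommGroup A] (w : UnitVector → ℝ →+ A) : LineSum →+ A :=
  DirectSum.toAddMonoid fun L =>
    -- Reversing the orientation changes the sign of both the difference and the coordinate, so the
    -- choice of `orient` does not matter.
    ((w (orient L)) - (w (-orient L))).comp (halfCoord L)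

theorem average_axisVector {A : Type*} [AddCommGroup A] (w : UnitVector → ℝ →+ A)
    (x : UnitVector) (t : ℝ) : average w (axisVector x t) = w x (t / 2) - w (-x) (t / 2) := by
  have hh : average w (axisVector x t) = (w (orient x.line) - w (-orient x.line))
      (halfCoord x.line ⟨t • x.val, x.line.1.smul_mem t x.val_mem_line⟩) :=
    DirectSum.toAddMonoid_of _ _ _
  have hc : halfCoord x.line ⟨t • x.val, x.line.1.smul_mem t x.val_mem_line⟩ =
      (t • x.val) ⬝ᵥ (orient x.line).val / 2 := rfl
  rw [hh, hc, AddMonoidHom.sub_apply, smul_dotProduct, smul_eq_mul]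
  rcases eq_or_eq_neg_of_mem (orient_mem x.line) x.val_mem_line with h | h <;> rw [h]
  · rw [x.dot_self, mul_one]
  · rw [UnitVector.neg_neg, neg_val, dotProduct_neg, x.dot_self, mul_neg, mul_one, neg_div, map_neg,
      map_neg, neg_sub_neg]

theorem map_axisVector_eq_half_sub {V : Type*} [AddCommGroup V] (F : LineSum →+ V)
    (x : UnitVector) (t : ℝ) :
    F (axisVector x t) = F (axisVector x (t / 2)) - F (axisVector x (-(t / 2))) := by
  have h := map_sub (F.comp (axisVector x)) (t / 2) (-(t / 2))
  rwa [sub_neg_eq_add, add_halves] at h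

/-! ### Cocycles with values in homomorphisms out of the sum of lines. -/

/-- A `2`-cocycle of `O(3)` with values in the homomorphisms out of `⨁ L, Lᵗ` is a coboundary. -/
theorem two_cocycle_eq_coboundary {V : Type*} [AddCommGroup V] (F : O3 → O3 → LineSum →+ V)
    (hF : ∀ g h k m, F h k (twistedAction g⁻¹ m) - F (g * h) k m + F g (h * k) m - F g h m = 0) :
    ∃ Λ : O3 → LineSum →+ V, ∀ g h m,
      F g h m = Λ h (twistedAction g⁻¹ m) - Λ (g * h) m + Λ g m := by
  have hf : IsActionCocycle (fun g h x => (F g h).comp (axisVector x)) := fun g h k x => by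
    ext t
    simpa [twistedAction_axisVector] using hF g h k (axisVector x t)
  obtain ⟨ν, hν⟩ := hf.eq_coboundary moveE₃_smul realHom_eq_zero_of_add_self
    (fun a ha b hb => stabilizer_e₃_comm ha hb) (σ := reflY) (fun a ha => inv_mul_reflY ha)
    (fun g h => by
      ext t
      simp [reflY_smul_e₃, axisVector_neg])
  refine ⟨fun g => average (ν g), fun g h m => ?_⟩
  suffices H : F g h = (average (ν h)).comp (twistedAction g⁻¹) - average (ν (g * h))
      + average (ν g) by rw [H]; rfl
  refine addHom_ext_axisVector fun x t => ?_
  have h1 := DFunLike.congr_fun (hν g h x) (t / 2)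
  have h2 := DFunLike.congr_fun (hν g h (-x)) (t / 2)
  simp only [AddMonoidHom.add_apply, AddMonoidHom.sub_apply, AddMonoidHom.comp_apply,
    axisVector_neg, UnitVector.smul_neg] at h1 h2
  simp only [AddMonoidHom.add_apply, AddMonoidHom.sub_apply, AddMonoidHom.comp_apply,
    twistedAction_axisVector, average_axisVector]
  rw [map_axisVector_eq_half_sub, h1, h2]
  abel

/-- The element of the stabilizer of `e₃` corresponding to the arrow `g` with target `x`. -/
def axisPart (g : O3) (x : UnitVector) : O3 := (moveE₃ x)⁻¹ * g * moveE₃ (g⁻¹ • x)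

theorem axisPart_mem (g : O3) (x : UnitVector) : axisPart g x ∈ MulAction.stabilizer O3 e₃ := by
  rw [MulAction.mem_stabilizer_iff]
  simp only [axisPart, mul_smul, moveE₃_smul, smul_inv_smul, moveE₃_inv_smul]

theorem axisPart_mul (g h : O3) (x : UnitVector) :
    axisPart (g * h) x = axisPart g x * axisPart h (g⁻¹ • x) := by
  simp only [axisPart, mul_inv_rev, mul_smul]
  group

/-- The angle cochain, inducing the isomorphism of `H₁(O(3), ⨁ L, Lᵗ)` with `ℝ ⊗ ℝ/ℤ`. -/
def angleCochain (g : O3) : LineSum →+ ℝ ⊗[ℤ] AddCircle (1 : ℝ) :=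
  average fun x => ((TensorProduct.mk ℤ ℝ (AddCircle (1 : ℝ))).flip
    (axisAngle (axisPart g x))).toAddMonoidHom

theorem angleCochain_axisVector (g : O3) (x : UnitVector) (t : ℝ) :
    angleCochain g (axisVector x t) = (t / 2) ⊗ₜ axisAngle (axisPart g x) -
      (t / 2) ⊗ₜ axisAngle (axisPart g (-x)) :=
  average_axisVector _ _ _

theorem angleCochain_mul (g h : O3) (m : LineSum) :
    angleCochain (g * h) m = angleCochain h (twistedAction g⁻¹ m) + angleCochain g m := by
  suffices H : angleCochain (g * h) =
      (angleCochain h).comp (twistedAction g⁻¹) + angleCochain g by rw [H]; rfl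
  refine addHom_ext_axisVector fun x t => ?_
  simp only [AddMonoidHom.add_apply, AddMonoidHom.comp_apply, twistedAction_axisVector,
    angleCochain_axisVector, axisPart_mul, axisAngle_mul (axisPart_mem _ _) (axisPart_mem _ _),
    TensorProduct.tmul_add, UnitVector.smul_neg]
  abel

theorem angleCochain_of_isRotationAbout {x : UnitVector} {g : O3} {θ : ℝ}
    (h : IsRotationAbout x.val θ g) (t : ℝ) :
    angleCochain g (axisVector x t) = t ⊗ₜ ((θ / Real.pi : ℝ) : AddCircle (1 : ℝ)) := by
  have key : ∀ {y : UnitVector} {φ : ℝ}, IsRotationAbout y.val φ g → axisPart g y = rotZ φ :=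
    fun {y φ} hy => by
      rw [axisPart, inv_smul_eq_iff.2 hy.smul_eq.symm, hy.conj_eq_rotZ (moveE₃_smul y)]
  -- Seen from `-x` the angle is `-θ`, so the two halves of the average add up.
  rw [angleCochain_axisVector, key h, key h.neg, axisAngle_rotZ, axisAngle_rotZ, neg_div,
    AddCircle.coe_neg, TensorProduct.tmul_neg, sub_neg_eq_add, ← TensorProduct.add_tmul,
    add_halves]

/-- A `1`-cocycle of `O(3)` with values in the homomorphisms out of `⨁ L, Lᵗ` factors through the
angle cochain up to a coboundary. -/
theorem one_cocycle_eq_add_angleCochain {V : Type*} [AddCommGroup V] (F : O3 → LineSum →+ V)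
    (hF : ∀ g h m, F (g * h) m = F h (twistedAction g⁻¹ m) + F g m) :
    ∃ (H : LineSum →+ V) (ψ : ℝ ⊗[ℤ] AddCircle (1 : ℝ) →+ V), ∀ g m,
      F g m = H m - H (twistedAction g⁻¹ m) + ψ (angleCochain g m) := by
  let p : O3 → UnitVector → ℝ →+ V := fun g x => (F g).comp (axisVector x)
  have hp : ∀ g h x, p (g * h) x = p h (g⁻¹ • x) + p g x := fun g h x => by
    ext t
    simpa [p, twistedAction_axisVector] using hF g h (axisVector x t)
  have hstab : ∀ {a} b, a ∈ MulAction.stabilizer O3 e₃ →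
      p (a * b) e₃ = p b e₃ + p a e₃ := fun {a} b ha => by
    rw [hp, inv_smul_eq_iff.2 (MulAction.mem_stabilizer_iff.1 ha).symm]
  have hrot : ∀ θ, rotZ θ ∈ MulAction.stabilizer O3 e₃ := rotZ_smul_e₃
  have hone : p 1 e₃ = 0 := by
    have := hstab (a := 1) 1 (one_mem _)
    rw [mul_one] at this
    exact left_eq_add.1 this
  -- An involution has value zero because `Hom(ℝ, V)` has no 2-torsion. The same reason kills the
  -- value at `rotZ π`, so `r` descends to `ℝ/ℤ` and not merely to `ℝ/2ℤ`.
  have hneg1 : p (-1) e₃ = 0 := by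
    refine realHom_eq_zero_of_add_self _ ?_
    rw [← hstab (-1) ((O3.neg_smul 1 e₃).trans (one_smul _ _)), neg_mul_neg, one_mul, hone]
  let r : ℝ →+ (ℝ →+ V) := AddMonoidHom.mk' (fun q => p (rotZ (Real.pi * q)) e₃) fun a b => by
    rw [mul_add, rotZ_add, hstab _ (hrot _), add_comm]
  have hr1 : r 1 = 0 := by
    refine realHom_eq_zero_of_add_self _ ?_
    rw [← map_add]
    change p (rotZ (Real.pi * (1 + 1))) e₃ = 0
    rw [one_add_one_eq_two, mul_comm, rotZ_two_pi, hone]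
  let ω : AddCircle (1 : ℝ) →+ (ℝ →+ V) :=
    QuotientAddGroup.lift _ r (AddSubgroup.zmultiples_le_of_mem (H := r.ker) hr1)
  have hω : ∀ a ∈ MulAction.stabilizer O3 e₃, ω (axisAngle a) = p a e₃ := fun a ha => by
    have h1 : ∀ θ : ℝ, ω ((θ / Real.pi : ℝ) : AddCircle (1 : ℝ)) = p (rotZ θ) e₃ := fun θ => by
      change p (rotZ (Real.pi * (θ / Real.pi))) e₃ = _
      rw [mul_div_cancel₀ _ Real.pi_ne_zero]
    obtain ⟨θ, rfl | rfl⟩ := exists_eq_rotZ_or_neg ha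
    · rw [axisAngle_rotZ, h1]
    · rw [axisAngle_neg_rotZ, h1, ← mul_neg_one, hstab _ (hrot θ), hneg1, zero_add]
  let ψ : ℝ ⊗[ℤ] AddCircle (1 : ℝ) →+ V := TensorProduct.liftAddHom ω.flip fun n t a => by
    rw [map_zsmul, map_zsmul, AddMonoidHom.smul_apply]
  have hψ : ∀ t a, ψ (t ⊗ₜ a) = ω a t := fun t a => rfl
  -- The two factorizations of `g * moveE₃ (g⁻¹ • x)` are compared; the `moveE₃` terms form the
  -- coboundary.
  have hmove : ∀ g x,
      p g x = p (moveE₃ x) x - p (moveE₃ (g⁻¹ • x)) (g⁻¹ • x) + p (axisPart g x) e₃ :=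
    fun g x => by
      have h1 := hp g (moveE₃ (g⁻¹ • x)) x
      have h2 := hp (moveE₃ x) (axisPart g x) x
      rw [moveE₃_inv_smul, show moveE₃ x * axisPart g x = g * moveE₃ (g⁻¹ • x) by
        simp only [axisPart]; group, h1] at h2
      rw [eq_sub_of_add_eq' h2]
      abel
  refine ⟨average fun x => p (moveE₃ x) x, ψ, fun g m => ?_⟩
  suffices H : F g = (average fun x => p (moveE₃ x) x)
      - (average fun x => p (moveE₃ x) x).comp (twistedAction g⁻¹) + ψ.comp (angleCochain g) by
    conv_lhs => rw [H]
    rfl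
  refine addHom_ext_axisVector fun x t => ?_
  have h1 := DFunLike.congr_fun (hmove g x) (t / 2)
  have h2 := DFunLike.congr_fun (hmove g (-x)) (t / 2)
  have h3 : F g (axisVector x t) = p g x (t / 2) - p g (-x) (t / 2) := by
    simp only [p, AddMonoidHom.comp_apply, axisVector_neg]
    exact map_axisVector_eq_half_sub _ _ _
  rw [h3, h1, h2]
  simp only [AddMonoidHom.add_apply, AddMonoidHom.sub_apply, AddMonoidHom.comp_apply,
    twistedAction_axisVector, average_axisVector, angleCochain_axisVector, map_sub, hψ,
    hω _ (axisPart_mem _ _), UnitVector.smul_neg]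
  abel

end LineSum

end

/-! ### Passage to group homology. -/

noncomputable section

open UnitVector LineSum groupHomology

namespace twistedLines

/-- The identification of `⨁ L, L` with the underlying group of `twistedLines`. -/
def ofLineSum : LineSum →+ twistedLines := AddMonoidHom.id LineSum

theorem subsingleton_H0 : Subsingleton (groupHomology twistedLines 0) := by
  refine subsingleton_of_forall_eq 0 fun z => ?_
  induction z using H0_induction_on with
  | h m =>
    let π : LineSum →+ H0 twistedLines := (H0π twistedLines).hom.toAddMonoidHom
    have hπ : ∀ g m, π (twistedAction g m) = π m := fun g m => by
      change H0π twistedLines (twistedLines.ρ g m) = H0π twistedLines m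
      rw [← coinvariantsMk_comp_H0Iso_inv]
      exact congrArg (H0Iso twistedLines).inv (Representation.Coinvariants.mk_self_apply twistedLines.ρ g m)
    suffices H : π = 0 from DFunLike.congr_fun H m
    refine addHom_ext_axisVector fun x t => ?_
    have hx : π (axisVector x (t / 2)) = π (axisVector x (-(t / 2))) := by
      -- This conjugate of `reflY` sends `x` to `-x`, so coinvariance identifies opposite vectors.
      have h := hπ (moveE₃ x * reflY * (moveE₃ x)⁻¹) (axisVector x (t / 2))
      rw [twistedAction_axisVector, mul_smul, moveE₃_inv_smul, mul_smul, reflY_smul_e₃,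
        UnitVector.smul_neg, moveE₃_smul, axisVector_neg] at h
      exact h.symm
    rw [map_axisVector_eq_half_sub, hx, sub_self]
    rfl

/-- The homomorphism on chains defined by a family of homomorphisms. -/
def chainHom {ι V : Type*} [AddCommGroup V] (F : ι → LineSum →+ V) :
    (ι →₀ twistedLines) →+ V :=
  Finsupp.liftAddHom F

theorem chainHom_single {ι V : Type*} [AddCommGroup V] (F : ι → LineSum →+ V) (i : ι)
    (m : LineSum) : chainHom F (Finsupp.single i (ofLineSum m)) = F i m :=
  Finsupp.liftAddHom_apply_single _ _ _

theorem chainHom_ext {ι V : Type*} [AddCommGroup V] {F F' : (ι →₀ twistedLines) →+ V}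
    (h : ∀ (i : ι) (m : LineSum),
      F (Finsupp.single i (ofLineSum m)) = F' (Finsupp.single i (ofLineSum m))) : F = F' :=
  Finsupp.addHom_ext h

/-- The homomorphisms `m ↦ [single i m]` to a quotient of a group of chains. -/
def singleMk {ι : Type*} (B : AddSubgroup (ι →₀ twistedLines)) (i : ι) :
    LineSum →+ (ι →₀ twistedLines) ⧸ B :=
  (QuotientAddGroup.mk' B).comp ((Finsupp.singleAddHom i).comp ofLineSum)

theorem singleMk_apply {ι : Type*} (B : AddSubgroup (ι →₀ twistedLines)) (i : ι) (m : LineSum) :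
    singleMk B i m = QuotientAddGroup.mk' B (Finsupp.single i (ofLineSum m)) := rfl

theorem d₁₀_single_eq (g : O3) (m : LineSum) :
    d₁₀ twistedLines (Finsupp.single g (ofLineSum m)) = (twistedAction g⁻¹ m - m : LineSum) :=
  d₁₀_single twistedLines g (ofLineSum m)

theorem d₂₁_single_eq (g h : O3) (m : LineSum) :
    d₂₁ twistedLines (Finsupp.single (g, h) (ofLineSum m)) =
      Finsupp.single h (ofLineSum (twistedAction g⁻¹ m)) - Finsupp.single (g * h) (ofLineSum m)
        + Finsupp.single g (ofLineSum m) :=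
  d₂₁_single _ _

theorem d₃₂_single_eq (g h k : O3) (m : LineSum) :
    d₃₂ twistedLines (Finsupp.single (g, h, k) (ofLineSum m)) =
      Finsupp.single (h, k) (ofLineSum (twistedAction g⁻¹ m))
        - Finsupp.single (g * h, k) (ofLineSum m) + Finsupp.single (g, h * k) (ofLineSum m)
        - Finsupp.single (g, h) (ofLineSum m) :=
  d₃₂_single _ _

theorem subsingleton_H2 : Subsingleton (groupHomology twistedLines 2) := by
  refine subsingleton_of_forall_eq 0 fun z => ?_
  induction z using H2_induction_on with
  | h z =>
    rw [H2π_eq_zero_iff]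
    -- The tautological cochain with values in chains modulo boundaries is a cocycle. Writing it as
    -- a coboundary factors the quotient map through `d₂₁`, which vanishes on cycles.
    obtain ⟨Λ, hΛ⟩ := two_cocycle_eq_coboundary
      (V := (O3 × O3 →₀ twistedLines) ⧸ (boundaries₂ twistedLines).toAddSubgroup)
      (fun g h => singleMk (boundaries₂ twistedLines).toAddSubgroup (g, h)) fun g h k m => by
        simp only [singleMk_apply]
        rw [← map_sub, ← map_add, ← map_sub, ← d₃₂_single_eq]
        exact (QuotientAddGroup.eq_zero_iff _).2 (LinearMap.mem_range_self _ _)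
    have key : QuotientAddGroup.mk' (boundaries₂ twistedLines).toAddSubgroup =
        (chainHom Λ).comp (d₂₁ twistedLines).hom.toAddMonoidHom := by
      refine chainHom_ext fun gh m => ?_
      obtain ⟨g, h⟩ := gh
      refine (hΛ g h m).trans ?_
      change _ = chainHom Λ (d₂₁ twistedLines (Finsupp.single (g, h) (ofLineSum m)))
      rw [d₂₁_single_eq, map_add, map_sub, chainHom_single, chainHom_single, chainHom_single]
    refine (QuotientAddGroup.eq_zero_iff z.1).1 ((DFunLike.congr_fun key z.1).trans ?_)
    have hz : (d₂₁ twistedLines).hom z.1 = 0 := z.2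
    change chainHom Λ ((d₂₁ twistedLines).hom z.1) = 0
    rw [hz, map_zero]

/-- The homomorphism on `1`-chains defined by the angle cochain. -/
def angleChain : (O3 →₀ twistedLines) →+ ℝ ⊗[ℤ] AddCircle (1 : ℝ) := chainHom angleCochain

theorem angleChain_eq_zero_of_mem_boundaries {z : O3 →₀ twistedLines}
    (hz : z ∈ boundaries₁ twistedLines) : angleChain z = 0 := by
  obtain ⟨y, rfl⟩ := hz
  suffices H : angleChain.comp (d₂₁ twistedLines).hom.toAddMonoidHom = 0 from
    DFunLike.congr_fun H y
  refine chainHom_ext fun gh m => ?_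
  obtain ⟨g, h⟩ := gh
  change angleChain (d₂₁ twistedLines (Finsupp.single (g, h) (ofLineSum m))) = 0
  rw [d₂₁_single_eq, map_add, map_sub, angleChain, chainHom_single, chainHom_single,
    chainHom_single, angleCochain_mul]
  abel

theorem mem_boundaries_of_angleChain_eq_zero {z : O3 →₀ twistedLines}
    (hz : z ∈ cycles₁ twistedLines) (h0 : angleChain z = 0) : z ∈ boundaries₁ twistedLines := by
  obtain ⟨H, ψ, hψ⟩ := one_cocycle_eq_add_angleCochain
    (V := (O3 →₀ twistedLines) ⧸ (boundaries₁ twistedLines).toAddSubgroup)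
    (fun g => singleMk (boundaries₁ twistedLines).toAddSubgroup g) fun g h m => by
      simp only [singleMk_apply]
      rw [← sub_eq_zero, ← map_add, ← map_sub, ← neg_eq_zero, ← map_neg]
      refine (QuotientAddGroup.eq_zero_iff _).2
        ⟨Finsupp.single (g, h) (ofLineSum m), (d₂₁_single_eq g h m).trans ?_⟩
      abel
  -- On cycles the `d₁₀` term disappears, so the class of a cycle depends only on its angle.
  have key : QuotientAddGroup.mk' (boundaries₁ twistedLines).toAddSubgroup =
      ψ.comp angleChain - H.comp (d₁₀ twistedLines).hom.toAddMonoidHom := by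
    refine chainHom_ext fun g m => ?_
    refine (hψ g m).trans ?_
    change _ = ψ (angleChain (Finsupp.single g (ofLineSum m))) - H (d₁₀ twistedLines (Finsupp.single g (ofLineSum m)))
    rw [d₁₀_single_eq, map_sub, angleChain, chainHom_single]
    abel
  refine (QuotientAddGroup.eq_zero_iff z).1 ((DFunLike.congr_fun key z).trans ?_)
  have hz' : (d₁₀ twistedLines).hom z = 0 := hz
  change ψ (angleChain z) - H ((d₁₀ twistedLines).hom z) = 0
  rw [hz', h0, map_zero, sub_eq_zero]
  exact (map_zero H).symm

theorem single_mem_cycles {x : UnitVector} {g : O3} {θ : ℝ} (h : IsRotationAbout x.val θ g)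
    (t : ℝ) : Finsupp.single g (ofLineSum (axisVector x t)) ∈ cycles₁ twistedLines := by
  rw [single_mem_cycles₁_iff]
  exact (twistedAction_axisVector g x t).trans (by rw [h.smul_eq]; rfl)

/-- The homomorphism on `1`-cycles defined by the angle cochain. -/
def angleCycle : cycles₁ twistedLines →ₗ[ℤ] ℝ ⊗[ℤ] AddCircle (1 : ℝ) :=
  angleChain.toIntLinearMap.comp (cycles₁ twistedLines).subtype

theorem angleCycle_single {x : UnitVector} {g : O3} {θ : ℝ} (h : IsRotationAbout x.val θ g)
    (t : ℝ) : angleCycle ⟨_, single_mem_cycles h t⟩ =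
      t ⊗ₜ ((θ / Real.pi : ℝ) : AddCircle (1 : ℝ)) :=
  (chainHom_single _ _ _).trans (angleCochain_of_isRotationAbout h t)

theorem angleCycle_surjective : Function.Surjective angleCycle := fun y => by
  induction y using TensorProduct.induction_on with
  | zero => exact ⟨0, map_zero _⟩
  | tmul t q =>
    obtain ⟨q, rfl⟩ := QuotientAddGroup.mk_surjective q
    refine ⟨_, (angleCycle_single (isRotationAbout_rotZ (q * Real.pi)) t).trans ?_⟩
    rw [mul_div_cancel_right₀ _ Real.pi_ne_zero]
  | add a b ha hb =>
    obtain ⟨a, rfl⟩ := ha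
    obtain ⟨b, rfl⟩ := hb
    exact ⟨a + b, map_add _ _ _⟩

/-- The projection of the `1`-cycles to the first homology. -/
def cycleClass : cycles₁ twistedLines →ₗ[ℤ] groupHomology twistedLines 1 := (H1π twistedLines).hom

theorem cycleClass_surjective : Function.Surjective cycleClass :=
  (ModuleCat.epi_iff_surjective (H1π twistedLines)).1 inferInstance

theorem ker_cycleClass_eq_ker_angleCycle :
    LinearMap.ker cycleClass = LinearMap.ker angleCycle := by
  ext z
  rw [LinearMap.mem_ker, LinearMap.mem_ker]
  exact (H1π_eq_zero_iff z).trans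
    ⟨angleChain_eq_zero_of_mem_boundaries, mem_boundaries_of_angleChain_eq_zero z.2⟩

/-- The isomorphism `H₁(O(3), ⨁ L, Lᵗ) ≃ ℝ ⊗ ℝ/ℤ` induced by the angle cochain. -/
def H1Equiv : groupHomology twistedLines 1 ≃ₗ[ℤ] ℝ ⊗[ℤ] AddCircle (1 : ℝ) :=
  (cycleClass.quotKerEquivOfSurjective cycleClass_surjective).symm ≪≫ₗ
    Submodule.quotEquivOfEq _ _ ker_cycleClass_eq_ker_angleCycle ≪≫ₗ
    angleCycle.quotKerEquivOfSurjective angleCycle_surjective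

theorem H1Equiv_cycleClass (z : cycles₁ twistedLines) : H1Equiv (cycleClass z) = angleCycle z := by
  have h : (cycleClass.quotKerEquivOfSurjective cycleClass_surjective).symm (cycleClass z) =
      Submodule.Quotient.mk z := by
    rw [LinearEquiv.symm_apply_eq]
    rfl
  rw [H1Equiv, LinearEquiv.trans_apply, LinearEquiv.trans_apply, h]
  rfl

end twistedLines

end

theorem theoremO :
    Subsingleton (groupHomology twistedLines 0) ∧
    (∃ e : groupHomology twistedLines 1 ≃+ ℝ ⊗[ℤ] AddCircle (1 : ℝ),
      ∀ (L : Line) (u : L.1) (t θ : ℝ) (g : O3),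
        (u : Fin 3 → ℝ) ⬝ᵥ (u : Fin 3 → ℝ) = 1 → IsRotationAbout u θ g →
        ∃ hz : Finsupp.single g (lineVector L (t • u)) ∈ groupHomology.cycles₁ twistedLines,
          e (groupHomology.H1π twistedLines
              ⟨Finsupp.single g (lineVector L (t • u)), hz⟩) =
            t ⊗ₜ[ℤ] ((θ / Real.pi : ℝ) : AddCircle (1 : ℝ))) ∧
    Subsingleton (groupHomology twistedLines 2) := by
  refine ⟨twistedLines.subsingleton_H0, ⟨twistedLines.H1Equiv.toAddEquiv, ?_⟩,
    twistedLines.subsingleton_H2⟩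
  intro L u t θ g hu hg
  have hv : lineVector L (t • u) = twistedLines.ofLineSum (UnitVector.axisVector ⟨u, hu⟩ t) :=
    UnitVector.of_eq_axisVector rfl u.2
  rw [hv]
  exact ⟨twistedLines.single_mem_cycles (x := ⟨u, hu⟩) hg t,
    (twistedLines.H1Equiv_cycleClass _).trans (twistedLines.angleCycle_single (x := ⟨u, hu⟩) hg t)⟩
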